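/- Let $k\ge 1$ and let $f_1,\dots,f_k\in\mathbb{C}[x]$ be nonzero polynomials with $f_i(0)=0$. Put $m_i=\deg f_i$, let $\mathrm{lead}(f_i)$ be the leading coefficient of $f_i$, and let $M=\sum_{i=1}^k m_i$. Let $n\ge 1$ be an integer, let $\mathcal{P}(n)$ be the set of all partitions of $[n]=\{1,\dots,n\}$ into non-empty blocks, partially ordered by refinement ($\pi\le\sigma$ if every block of $\pi$ is contained in a block of $\sigma$), let $1_n=\{[n]\}$ be its largest element, and let $\mu_n$ be the Möbius function of the finite poset $\mathcal{P}(n)$, i.e. the inverse of the zeta function ($\zeta(\pi,\sigma)=1$ for $\pi\le\sigma$) under the convolution $(F*G)(\pi,\sigma)=\sum_{\pi\le\rho\le\sigma}F(\pi,\rho)G(\rho,\sigma)$. Then $$ \sum_{\pi\in\mathcal{P}(n)}\left(\prod_{i=1}^k\Bigl(\sum_{V\in\pi}f_i(|V|)\Bigr)\right)\mu_n(\pi,1_n) =\begin{cases} (n-1)!\,n^{k-1}\displaystyle\prod_{i=1}^k m_i\,\mathrm{lead}(f_i), & n=M-(k-1),\\ 0, & n>M-(k-1). \end{cases} $$ 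-/

import Mathlib

open Polynomial

/-- The partitions of an `n`-element set `[n]` (modelled by `Fin n`) into non-empty, pairwise
disjoint blocks; `π.parts` is the set of blocks.  Mathlib orders them by refinement: `π ≤ σ` iff
every block of `π` is contained in a block of `σ`. -/
abbrev SetPartition (n : ℕ) : Type :=
  Finpartition (Finset.univ : Finset (Fin n))

/-- The largest partition `1_n`. -/
def oneHat (n : ℕ) : SetPartition n := ⊤

/-- For `n ≥ 1`, the largest partition has the single block `[n]`. -/
theorem oneHat_parts {n : ℕ} (hn : 1 ≤ n) : (oneHat n).parts = {Finset.univ} := by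
  have h : (Finset.univ : Finset (Fin n)) ≠ ⊥ := by
    intro h
    have := Finset.mem_univ (⟨0, hn⟩ : Fin n)
    rw [h] at this
    simp at this
  show Finpartition.parts (dite _ _ _) = _
  rw [dif_neg h]
  rfl

open Classical in
/-- The intervals of the finite poset of partitions are finite. -/
noncomputable instance instLocallyFiniteOrderSetPartition (n : ℕ) :
    LocallyFiniteOrder (SetPartition n) :=
  Fintype.toLocallyFiniteOrder

open Classical in
/-- The Möbius function of the poset of partitions of `[n]`: the inverse of the zeta function in
the incidence algebra with complex values. -/
noncomputable def moebius (n : ℕ) (π σ : SetPartition n) : ℂ :=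
  IncidenceAlgebra.mu ℂ π σ

/-- The sum over all partitions `π` of `[n]` of `∏ i, (∑ V ∈ π, f i (|V|))` times
`moebius n π 1_n`. -/
noncomputable def partitionSum {k : ℕ} (f : Fin k → ℂ[X]) (n : ℕ) : ℂ :=
  ∑ π : SetPartition n,
    (∏ i : Fin k, ∑ V ∈ π.parts, (f i).eval (V.card : ℂ)) * moebius n π (oneHat n)

/-! By multilinearity it suffices to treat monomials `x ^ j i` with `1 ≤ j i`. Then `∑ V ∈ π.parts,
|V| ^ j i` counts the `j i`-tuples lying in a single block of `π`, so the product over `i` counts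
families of hyperedges whose partition into components is at most `π`. Möbius inversion keeps
exactly the families that connect `[n]` (`sum_prod_card_pow_mul_moebius`).

Such a family reaches at most `∑ (j i - 1) + 1` vertices (`Connects.card_le`), whence the vanishing.
At equality only the top-degree monomials survive, and the connecting families are hypertrees,
counted by a Cayley-type formula (`sum_mul_connectSum`). Its proof contracts one hyperedge at a
time. Vertex weights are needed there: a merged vertex stands for several old ones and inherits
their total weight. -/

/-- A family of hyperedges, each given as a tuple of vertices, connects the vertex set `V` if every
non-empty subset of `V` that is closed under passing along hyperedges is all of `V`. -/
def Connects {V : Type} {k : ℕ} {j : Fin k → ℕ} (φ : ∀ i, Fin (j i) → V) : Prop :=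
  ∀ s : Set V, s.Nonempty → (∀ i a b, φ i a ∈ s → φ i b ∈ s) → s = Set.univ

/-! ### Contraction of a hyperedge and the bound on connected vertex sets -/

open Classical in
/-- The map that contracts the set `e` of vertices to a single vertex. -/
noncomputable def contractSet {V : Type} (e : Finset V) (v : V) : Option {v // v ∉ e} :=
  if h : v ∈ e then none else some ⟨v, h⟩

theorem contract_of_mem {V : Type} {e : Finset V} {v : V} (h : v ∈ e) :
    contractSet e v = none := dif_pos h

theorem contract_of_notMem {V : Type} {e : Finset V} {v : V} (h : v ∉ e) :
    contractSet e v = some ⟨v, h⟩ := dif_neg h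

theorem contract_eq_none_iff {V : Type} {e : Finset V} {v : V} :
    contractSet e v = none ↔ v ∈ e := by
  unfold contractSet; split_ifs <;> simp_all

theorem contract_eq_some_iff {V : Type} {e : Finset V} {v : V} {w : {v // v ∉ e}} :
    contractSet e v = some w ↔ v = w := by
  unfold contractSet
  split_ifs with h
  · simp only [false_iff]
    rintro rfl
    exact w.2 h
  · simp [Subtype.ext_iff]

theorem contract_surjective {V : Type} {e : Finset V} (he : e.Nonempty) :
    Function.Surjective (contractSet e) := by
  rintro (_ | w)
  · exact he.imp fun v hv => contract_of_mem hv
  · exact ⟨w, contract_eq_some_iff.2 rfl⟩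

theorem contract_eq_contract {V : Type} {e : Finset V} {u v : V}
    (h : contractSet e u = contractSet e v) : u = v ∨ u ∈ e ∧ v ∈ e := by
  by_cases hu : u ∈ e
  · rw [contract_of_mem hu, eq_comm, contract_eq_none_iff] at h
    exact Or.inr ⟨hu, h⟩
  · rw [contract_of_notMem hu, eq_comm, contract_eq_some_iff] at h
    exact Or.inl h.symm

/-- Closed sets correspond under image and preimage, since a closed set meeting the edge contains
it. Non-emptiness of the edge makes the contraction surjective. -/
theorem connects_iff_contract {V : Type} [DecidableEq V] {k : ℕ} {j : Fin (k + 1) → ℕ} (hj : 1 ≤ j 0)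
    (φ : ∀ i, Fin (j i) → V) :
    Connects φ ↔
      Connects (fun i a => contractSet (Finset.univ.image (φ 0)) (φ (Fin.succ i) a)) := by
  set e := Finset.univ.image (φ 0) with he
  have mem_e : ∀ a, φ 0 a ∈ e := fun a => Finset.mem_image_of_mem _ (Finset.mem_univ a)
  have hsurj : Function.Surjective (contractSet e) := contract_surjective ⟨_, mem_e ⟨0, hj⟩⟩
  constructor
  · intro h s hs hcl
    have := h (contractSet e ⁻¹' s) (hs.preimage hsurj) (by
      intro i
      refine Fin.cases ?_ (fun i => hcl i) i
      intro a b hab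
      rw [Set.mem_preimage, contract_of_mem (mem_e _)] at *
      exact hab)
    rw [Set.eq_univ_iff_forall] at this ⊢
    intro w
    obtain ⟨v, rfl⟩ := hsurj w
    exact this v
  · intro h s hs hcl
    have key : ∀ v, contractSet e v ∈ contractSet e '' s → v ∈ s := by
      rintro v ⟨u, hu, huv⟩
      rcases contract_eq_contract huv with rfl | ⟨h1, h2⟩
      · exact hu
      · obtain ⟨a, -, rfl⟩ := Finset.mem_image.1 h1
        obtain ⟨b, -, rfl⟩ := Finset.mem_image.1 h2
        exact hcl 0 a b hu
    have := h (contractSet e '' s) (hs.image _) fun i a b hab =>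
      Set.mem_image_of_mem _ (hcl _ a b (key _ hab))
    rw [Set.eq_univ_iff_forall] at this ⊢
    exact fun v => key v (this _)

theorem card_contract {V : Type} [Fintype V] [DecidableEq V] (e : Finset V) :
    Fintype.card (Option {v // v ∉ e}) + e.card = Fintype.card V + 1 := by
  have := Fintype.card_subtype_compl (fun v => v ∈ e)
  have h2 := e.card_le_univ
  simp only [Fintype.card_option, Fintype.card_coe] at *
  omega

/-- Contracting the first hyperedge removes at most `j 0 - 1` vertices; with no hyperedges every
singleton is closed, so at most one vertex remains. -/
theorem Connects.card_le {k : ℕ} : ∀ {V : Type} [Fintype V] {j : Fin k → ℕ}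
    {φ : ∀ i, Fin (j i) → V}, (∀ i, 1 ≤ j i) → Connects φ →
    Fintype.card V + k ≤ ∑ i, j i + 1 := by
  classical
  induction k with
  | zero =>
    intro V _ j φ hj h
    have : Subsingleton V := ⟨fun u v => by
      have := h {u} ⟨u, rfl⟩ (fun i => i.elim0)
      exact ((Set.eq_univ_iff_forall.1 this) v).symm⟩
    have := Fintype.card_le_one_iff_subsingleton.2 this
    simpa
  | succ k ih =>
    intro V _ j φ hj h
    have h1 := ih (fun i => hj i.succ) ((connects_iff_contract (hj 0) φ).1 h)
    have h2 := card_contract (Finset.univ.image (φ 0))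
    have h3 : (Finset.univ.image (φ 0)).card ≤ j 0 := by
      simpa using Finset.card_image_le (s := Finset.univ) (f := φ 0)
    rw [Fin.sum_univ_succ]
    omega

/-! ### Weighted count of hypertrees -/

/-- The sum of a weight over the tuples with prescribed image under fibrewise maps. -/
theorem sum_pi_comp_mul_prod {ι : Type} [Fintype ι] [DecidableEq ι] {A B : ι → Type} [∀ i, Fintype (A i)]
    [∀ i, Fintype (B i)] [∀ i, DecidableEq (B i)] (q : ∀ i, A i → B i) (w : ∀ i, A i → ℂ) (F : (∀ i, B i) → ℂ) :
    ∑ φ : ∀ i, A i, F (fun i => q i (φ i)) * ∏ i, w i (φ i) =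
      ∑ ψ : ∀ i, B i, F ψ * ∏ i, ∑ a with q i a = ψ i, w i a := by
  rw [← Finset.sum_fiberwise (s := Finset.univ) (g := fun φ : ∀ i, A i => fun i => q i (φ i))]
  refine Finset.sum_congr rfl fun ψ _ => ?_
  rw [Finset.prod_univ_sum, Finset.mul_sum]
  refine Finset.sum_congr ?_ ?_
  · ext φ
    simp [funext_iff]
  · intro φ hφ
    rw [Fintype.mem_piFinset] at hφ
    congr 2
    ext i
    simpa using hφ i

open Classical in
/-- The weighted number of families of hyperedges that connect `V`. -/
noncomputable def connectSum (V : Type) [Fintype V] {k : ℕ} (j : Fin k → ℕ) (x : V → ℂ) : ℂ :=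
  ∑ φ : ∀ i, Fin (j i) → V, (if Connects φ then 1 else 0) * ∏ i, ∏ a, x (φ i a)

open Classical in
theorem sum_connects_comp {V W : Type} [Fintype V] [Fintype W] [DecidableEq W] {k : ℕ} (j : Fin k → ℕ)
    (x : V → ℂ) (q : V → W) :
    ∑ φ : ∀ i, Fin (j i) → V,
      (if Connects (fun i a => q (φ i a)) then (1 : ℂ) else 0) * ∏ i, ∏ a, x (φ i a) =
      connectSum W j (fun w => ∑ v with q v = w, x v) := by
  have := sum_pi_comp_mul_prod (A := fun i => Fin (j i) → V) (B := fun i => Fin (j i) → W)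
    (fun i φ a => q (φ a)) (fun i φ => ∏ a, x (φ a)) (fun ψ => if Connects ψ then 1 else 0)
  refine this.trans (Finset.sum_congr rfl fun ψ _ => ?_)
  congr 1
  refine Finset.prod_congr rfl fun i _ => ?_
  rw [Finset.prod_univ_sum]
  refine Finset.sum_congr ?_ fun _ _ => rfl
  ext φ
  simp [funext_iff]

theorem connectSum_succ {V : Type} [Fintype V] [DecidableEq V] {k : ℕ} {j : Fin (k + 1) → ℕ}
    (hj : 1 ≤ j 0) (x : V → ℂ) :
    connectSum V j x = ∑ ψ : Fin (j 0) → V, (∏ a, x (ψ a)) *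
      connectSum (Option {v // v ∉ Finset.univ.image ψ}) (fun i => j (Fin.succ i))
        (fun w => ∑ v with contractSet (Finset.univ.image ψ) v = w, x v) := by
  classical
  rw [connectSum, ← (Fin.consEquiv fun i => Fin (j i) → V).sum_comp, Fintype.sum_prod_type]
  refine Finset.sum_congr rfl fun ψ _ => ?_
  rw [← sum_connects_comp, Finset.mul_sum]
  refine Finset.sum_congr rfl fun φ _ => ?_
  have hc : Connects (Fin.cons ψ φ : ∀ i, Fin (j i) → V) ↔
      Connects fun i a => contractSet (Finset.univ.image ψ) (φ i a) := by
    exact connects_iff_contract hj (Fin.cons ψ φ : ∀ i, Fin (j i) → V)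
  simp only [Fin.prod_univ_succ, Fin.consEquiv, Equiv.coe_fn_mk, Fin.cons_zero, Fin.cons_succ, hc]
  exact mul_left_comm (G := ℂ) _ _ _

theorem sum_contract_weight {V : Type} [Fintype V] [DecidableEq V] (e : Finset V) (x : V → ℂ) :
    ∑ w, ∑ v with contractSet e v = w, x v = ∑ v, x v :=
  Finset.sum_fiberwise _ _ _

/-- The merged vertex has weight `∑ v ∈ e, x v` and replaces the factors in `e`; multiplying by
those factors avoids dividing by weights that may vanish. -/
theorem prod_contract_weight {V : Type} [Fintype V] [DecidableEq V] (e : Finset V) (x : V → ℂ) :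
    (∏ v ∈ e, x v) * ∏ w, ∑ v with contractSet e v = w, x v = (∑ v ∈ e, x v) * ∏ v, x v := by
  have h1 : ∀ w : {v // v ∉ e}, ∑ v with contractSet e v = some w, x v = x w := by
    intro w
    simp [contract_eq_some_iff, Finset.filter_eq']
  have h2 : ∑ v with contractSet e v = none, x v = ∑ v ∈ e, x v := by
    simp [contract_eq_none_iff]
  rw [Fintype.prod_option, h2]
  simp only [h1]
  rw [← Finset.prod_subtype eᶜ (fun v => Finset.mem_compl) x, mul_left_comm,
    Finset.prod_mul_prod_compl]

theorem connectSum_eq_zero {V : Type} [Fintype V] {k : ℕ} {j : Fin k → ℕ}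
    (hj : ∀ i, 1 ≤ j i) (hV : ∑ i, j i + 1 < Fintype.card V + k) (x : V → ℂ) :
    connectSum V j x = 0 := by
  refine Finset.sum_eq_zero fun φ _ => ?_
  rw [if_neg fun h => absurd (h.card_le hj) (by omega), zero_mul]

-- By symmetry under transpositions, every vertex is the value at `a` of equally many injections,
-- namely `(|V| - 1)! / (|V| - m)!`.
open Classical in
theorem sum_injective_apply {V : Type} [Fintype V] {m : ℕ} (hm : m ≤ Fintype.card V) (a : Fin m)
    (x : V → ℂ) :
    ((Fintype.card V - m).factorial : ℂ) *
        ∑ ψ : Fin m → V with Function.Injective ψ, x (ψ a) =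
      ((Fintype.card V - 1).factorial : ℂ) * ∑ v, x v := by
  set c : V → ℕ := fun v =>
    (Finset.univ.filter fun ψ : Fin m → V => Function.Injective ψ ∧ ψ a = v).card with hc
  have hconst : ∀ u v, c u = c v := by
    intro u v
    refine Finset.card_equiv (Equiv.arrowCongr (Equiv.refl _) (Equiv.swap u v)) ?_
    intro ψ
    have : (Equiv.refl (Fin m)).arrowCongr (Equiv.swap u v) ψ = Equiv.swap u v ∘ ψ := rfl
    simp [Equiv.swap_apply_eq_iff, this]
  have hsum : ∑ v, c v = (Fintype.card V).descFactorial m := by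
    have h := Fintype.card_embedding_eq (α := Fin m) (β := V)
    rw [Fintype.card_fin, ← Fintype.card_congr (Equiv.subtypeInjectiveEquivEmbedding (Fin m) V),
      Fintype.card_subtype] at h
    rw [← h, Finset.card_eq_sum_card_fiberwise (f := fun ψ => ψ a) (t := Finset.univ)
      (fun _ _ => by simp)]
    simp [hc, Finset.filter_filter]
  have hpos : 0 < m := a.pos
  have hcv : ∀ v, (Fintype.card V - m).factorial * c v = (Fintype.card V - 1).factorial := by
    intro v
    have h1 : ∑ u, c u = Fintype.card V * c v := by
      rw [Finset.sum_congr rfl fun u _ => hconst u v]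
      simp
    have h2 := Nat.factorial_mul_descFactorial hm
    rw [← hsum, h1] at h2
    have h3 : 0 < Fintype.card V := by omega
    rw [← Nat.mul_factorial_pred h3.ne'] at h2
    apply Nat.eq_of_mul_eq_mul_left h3
    rw [← h2]
    ring
  have hx : ∑ ψ : Fin m → V with Function.Injective ψ, x (ψ a) = ∑ v, (c v : ℂ) * x v := by
    rw [← Finset.sum_fiberwise (g := fun ψ : Fin m → V => ψ a)]
    refine Finset.sum_congr rfl fun v _ => ?_
    rw [Finset.filter_filter, Finset.sum_congr rfl (g := fun _ => x v)]
    · simp [hc]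
    · intro ψ hψ
      rw [(Finset.mem_filter.1 hψ).2.2]
  rw [hx, Finset.mul_sum, Finset.mul_sum]
  refine Finset.sum_congr rfl fun v _ => ?_
  rw [← mul_assoc, ← Nat.cast_mul, hcv]

/-- The weighted count of hypertrees with prescribed edge sizes. -/
theorem sum_mul_connectSum {k : ℕ} : ∀ {V : Type} [Fintype V] [Nonempty V] {j : Fin k → ℕ},
    (∀ i, 1 ≤ j i) → Fintype.card V + k = ∑ i, j i + 1 → ∀ x : V → ℂ,
    (∑ v, x v) * connectSum V j x =
      (Fintype.card V - 1).factorial * (∏ i, (j i : ℂ)) * (∏ v, x v) * (∑ v, x v) ^ k := by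
  classical
  induction k with
  | zero =>
    intro V _ _ j hj hV x
    -- Here the count is `1`; the extra factor `∑ v, x v` on the left replaces an exponent `k - 1 =
    -- -1` on the right.
    have h1 : Fintype.card V = 1 := by simpa using hV
    obtain ⟨v, hv⟩ := Fintype.card_eq_one_iff.1 h1
    have : Unique V := ⟨⟨v⟩, hv⟩
    have hc : ∀ φ : ∀ i, Fin (j i) → V, Connects φ := by
      intro φ s hs _
      exact Subsingleton.eq_univ_of_nonempty hs
    simp [connectSum, hc]
  | succ k ih =>
    intro V _ _ j hj hV x
    have hsum : k ≤ ∑ i : Fin k, j i.succ := by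
      simpa using Finset.sum_le_sum (s := Finset.univ) fun (i : Fin k) _ => hj i.succ
    rw [Fin.sum_univ_succ] at hV
    have hle : j 0 ≤ Fintype.card V := by omega
    rw [connectSum_succ (hj 0), Finset.mul_sum]
    have hterm : ∀ ψ : Fin (j 0) → V, (∑ v, x v) * ((∏ a, x (ψ a)) *
        connectSum (Option {v // v ∉ Finset.univ.image ψ}) (fun i => j (Fin.succ i))
          (fun w => ∑ v with contractSet (Finset.univ.image ψ) v = w, x v)) =
        if Function.Injective ψ then ((Fintype.card V - j 0).factorial : ℂ) *
          (∏ i : Fin k, (j i.succ : ℂ)) * (∏ v, x v) * (∑ v, x v) ^ k * ∑ a, x (ψ a) else 0 := by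
      intro ψ
      have hcard := card_contract (Finset.univ.image ψ)
      split_ifs with hψ
      · have he : (Finset.univ.image ψ).card = j 0 := by
          rw [Finset.card_image_of_injective _ hψ, Finset.card_fin]
        have := ih (V := Option {v // v ∉ Finset.univ.image ψ}) (fun i => hj i.succ) (by omega)
          (fun w => ∑ v with contractSet (Finset.univ.image ψ) v = w, x v)
        rw [sum_contract_weight] at this
        have h2 := prod_contract_weight (Finset.univ.image ψ) x
        rw [Finset.prod_image hψ.injOn, Finset.sum_image hψ.injOn] at h2
        rw [mul_left_comm, this, show Fintype.card (Option {v // v ∉ Finset.univ.image ψ}) - 1 =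
          Fintype.card V - j 0 by omega]
        linear_combination ((Fintype.card V - j 0).factorial : ℂ) *
          (∏ i : Fin k, (j i.succ : ℂ)) * (∑ v, x v) ^ k * h2
      -- A repeated vertex wastes a slot: the contraction leaves too many vertices for the remaining
      -- hyperedges to connect.
      · have he : (Finset.univ.image ψ).card < j 0 := by
          refine lt_of_le_of_ne (by simpa using Finset.card_image_le (s := Finset.univ) (f := ψ)) ?_
          intro h
          have := Finset.card_image_iff.1 (h.trans (Finset.card_fin _).symm)
          rw [Finset.coe_univ, Set.injOn_univ] at this
          exact hψ this
        rw [connectSum_eq_zero (fun i => hj i.succ) (by omega), mul_zero, mul_zero]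
    rw [Finset.sum_congr rfl fun ψ _ => hterm ψ, ← Finset.sum_filter, ← Finset.mul_sum,
      Finset.sum_comm, Fin.prod_univ_succ]
    have h3 := fun a : Fin (j 0) => sum_injective_apply hle a x
    have h4 : ((Fintype.card V - j 0).factorial : ℂ) *
        ∑ a, ∑ ψ : Fin (j 0) → V with Function.Injective ψ, x (ψ a) =
        j 0 * (((Fintype.card V - 1).factorial : ℂ) * ∑ v, x v) := by
      rw [Finset.mul_sum, Finset.sum_congr rfl fun a _ => h3 a]
      simp
    linear_combination (∏ i : Fin k, (j i.succ : ℂ)) * (∏ v, x v) * (∑ v, x v) ^ k * h4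

/-! ### Connected components and Möbius inversion -/

/-- Two vertices are related if no union of connected components of the hyperedges `φ` separates
them. -/
def connectedSetoid {V : Type} {k : ℕ} {j : Fin k → ℕ} (φ : ∀ i, Fin (j i) → V) : Setoid V where
  r u v := ∀ s : Set V, (∀ i a b, φ i a ∈ s → φ i b ∈ s) → (u ∈ s ↔ v ∈ s)
  iseqv := ⟨fun _ _ _ => Iff.rfl, fun h s hs => (h s hs).symm,
    fun h h' s hs => (h s hs).trans (h' s hs)⟩

theorem connects_iff_forall_rel {V : Type} {k : ℕ} {j : Fin k → ℕ} (φ : ∀ i, Fin (j i) → V) :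
    Connects φ ↔ ∀ u v, connectedSetoid φ u v := by
  constructor
  · intro h u v s hs
    constructor <;> intro hu <;> rw [h s ⟨_, hu⟩ hs] <;> trivial
  · rintro h s ⟨u, hu⟩ hs
    exact Set.eq_univ_iff_forall.2 fun v => (h u v s hs).1 hu

open Classical in
/-- The partition of `[n]` into the connected components of a family of hyperedges. -/
noncomputable def components {n k : ℕ} {j : Fin k → ℕ} (φ : ∀ i, Fin (j i) → Fin n) :
    SetPartition n :=
  Finpartition.ofSetoid (connectedSetoid φ)

theorem mem_part_components {n k : ℕ} {j : Fin k → ℕ} {φ : ∀ i, Fin (j i) → Fin n} {u v : Fin n} :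
    v ∈ (components φ).part u ↔ connectedSetoid φ u v := by
  classical
  exact Finpartition.mem_part_ofSetoid_iff_rel

theorem SetPartition.le_iff {n : ℕ} {π σ : SetPartition n} :
    π ≤ σ ↔ ∀ u v, v ∈ π.part u → v ∈ σ.part u := by
  constructor
  · intro h u v huv
    obtain ⟨c, hc, hb⟩ := h (π.part_mem.2 (Finset.mem_univ u))
    rw [σ.part_eq_of_mem hc (hb (π.mem_part (Finset.mem_univ u)))]
    exact hb huv
  · intro h b hb
    obtain ⟨u, hu⟩ := π.nonempty_of_mem_parts hb
    refine ⟨σ.part u, σ.part_mem.2 (Finset.mem_univ u), fun v hv => h u v ?_⟩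
    rwa [π.part_eq_of_mem hb hu]

theorem components_le_iff {n k : ℕ} {j : Fin k → ℕ} {φ : ∀ i, Fin (j i) → Fin n}
    {π : SetPartition n} :
    components φ ≤ π ↔ ∀ i a b, φ i b ∈ π.part (φ i a) := by
  rw [SetPartition.le_iff]
  constructor
  · intro h i a b
    exact h _ _ (mem_part_components.2 fun s hs => ⟨hs i a b, hs i b a⟩)
  · intro h u v huv
    refine (mem_part_components.1 huv (π.part u : Set (Fin n)) ?_).1
      (Finset.mem_coe.2 (π.mem_part (Finset.mem_univ u)))
    intro i a b ha
    have := π.part_eq_of_mem (π.part_mem.2 (Finset.mem_univ u)) (Finset.mem_coe.1 ha)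
    exact this ▸ h i a b

theorem components_eq_oneHat_iff {n k : ℕ} {j : Fin k → ℕ} {φ : ∀ i, Fin (j i) → Fin n} :
    components φ = oneHat n ↔ Connects φ := by
  rw [connects_iff_forall_rel, oneHat, ← top_le_iff, SetPartition.le_iff]
  refine forall₂_congr fun u v => ?_
  have h : v ∈ (⊤ : SetPartition n).part u := by
    have h1 := oneHat_parts (n := n) u.pos
    rw [oneHat] at h1
    rw [Finpartition.part_eq_of_mem _ (h1 ▸ Finset.mem_singleton_self _) (Finset.mem_univ u)]
    exact Finset.mem_univ v
  rw [mem_part_components]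
  simp [h]

-- This is the defining sum of the Möbius function over the interval from `components φ` to the top.
open Classical in
theorem sum_moebius_eq {n k : ℕ} {j : Fin k → ℕ} (φ : ∀ i, Fin (j i) → Fin n) :
    ∑ π : SetPartition n, (if components φ ≤ π then 1 else 0) * moebius n π (oneHat n) =
      if Connects φ then 1 else 0 := by
  have h := IncidenceAlgebra.sum_Icc_mu_left (𝕜 := ℂ) (components φ) (oneHat n)
  simp only [components_eq_oneHat_iff] at h
  rw [← h]
  simp only [ite_mul, one_mul, zero_mul, ← Finset.sum_filter]
  refine Finset.sum_congr ?_ fun _ _ => rfl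
  ext π
  simp only [Finset.mem_filter, Finset.mem_univ, true_and, Finset.mem_Icc]
  exact ⟨fun h => ⟨h, le_top (a := π)⟩, And.left⟩

-- A tuple inside a block determines that block as the one containing its first entry; this needs `1
-- ≤ m`, as the empty tuple lies in every block.
open Classical in
theorem sum_card_pow {n m : ℕ} (hm : 1 ≤ m) (π : SetPartition n) :
    ∑ V ∈ π.parts, (V.card : ℂ) ^ m =
      ∑ ψ : Fin m → Fin n, if ∀ a b, ψ b ∈ π.part (ψ a) then 1 else 0 := by
  have h1 : ∀ V : Finset (Fin n), (V.card : ℂ) ^ m =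
      ∑ ψ : Fin m → Fin n, if ∀ a, ψ a ∈ V then 1 else 0 := by
    intro V
    rw [← Finset.sum_filter, Finset.sum_const, nsmul_one, show (Finset.univ.filter
      fun ψ : Fin m → Fin n => ∀ a, ψ a ∈ V) = Fintype.piFinset fun _ => V by ext; simp]
    simp
  simp only [h1]
  rw [Finset.sum_comm]
  refine Finset.sum_congr rfl fun ψ _ => ?_
  have key : ∀ V ∈ π.parts, (∀ a, ψ a ∈ V) ↔
      V = π.part (ψ ⟨0, hm⟩) ∧ ∀ a b, ψ b ∈ π.part (ψ a) := by
    intro V hV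
    constructor
    · intro h
      exact ⟨(π.part_eq_of_mem hV (h _)).symm, fun a b => by
        rw [π.part_eq_of_mem hV (h a)]; exact h b⟩
    · rintro ⟨rfl, h⟩ a
      exact h _ a
  rw [Finset.sum_congr rfl fun V hV => if_congr (key V hV) rfl rfl]
  by_cases h : ∀ a b, ψ b ∈ π.part (ψ a)
  · simp [h]
  · simp [h]

/-- The sum over partitions for monomials counts families of hyperedges connecting `[n]`. -/
theorem sum_prod_card_pow_mul_moebius {n k : ℕ} {j : Fin k → ℕ} (hj : ∀ i, 1 ≤ j i) :
    ∑ π : SetPartition n, (∏ i, ∑ V ∈ π.parts, (V.card : ℂ) ^ j i) * moebius n π (oneHat n) =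
      connectSum (Fin n) j 1 := by
  classical
  have h1 : ∀ π : SetPartition n, ∏ i, ∑ V ∈ π.parts, (V.card : ℂ) ^ j i =
      ∑ φ : ∀ i, Fin (j i) → Fin n, if components φ ≤ π then 1 else 0 := by
    intro π
    rw [Finset.prod_congr rfl fun i _ => sum_card_pow (hj i) π, Finset.prod_univ_sum,
      Fintype.piFinset_univ]
    refine Finset.sum_congr rfl fun φ _ => ?_
    rw [Finset.prod_ite_zero]
    simp [components_le_iff]
  simp only [h1, Finset.sum_mul]
  rw [Finset.sum_comm, connectSum]
  refine Finset.sum_congr rfl fun φ _ => ?_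
  rw [sum_moebius_eq]
  simp

/-! ### From monomials to polynomials -/

theorem sum_eval_eq {n d : ℕ} {p : ℂ[X]} (hp : p.eval 0 = 0) (hd : p.natDegree = d)
    (π : SetPartition n) :
    ∑ V ∈ π.parts, p.eval (V.card : ℂ) =
      ∑ e ∈ Finset.Icc 1 d, p.coeff e * ∑ V ∈ π.parts, (V.card : ℂ) ^ e := by
  simp only [Finset.mul_sum]
  rw [Finset.sum_comm]
  refine Finset.sum_congr rfl fun V _ => ?_
  rw [eval_eq_sum_range, hd, Finset.range_eq_Ico, Finset.sum_eq_sum_Ico_succ_bot (Nat.succ_pos d),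
    coeff_zero_eq_eval_zero, hp, zero_mul, zero_add]
  rfl

theorem partitionSum_eq {n k : ℕ} {f : Fin k → ℂ[X]} {m : Fin k → ℕ}
    (hf : ∀ i, (f i).eval 0 = 0) (hm : ∀ i, (f i).natDegree = m i) :
    partitionSum f n = ∑ j ∈ Fintype.piFinset fun i => Finset.Icc 1 (m i),
      (∏ i, (f i).coeff (j i)) * connectSum (Fin n) j 1 := by
  have h1 : ∀ π : SetPartition n, ∏ i, ∑ V ∈ π.parts, (f i).eval (V.card : ℂ) =
      ∑ j ∈ Fintype.piFinset fun i => Finset.Icc 1 (m i),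
        (∏ i, (f i).coeff (j i)) * ∏ i, ∑ V ∈ π.parts, (V.card : ℂ) ^ j i := by
    intro π
    rw [Finset.prod_congr rfl fun i _ => sum_eval_eq (hf i) (hm i) π, Finset.prod_univ_sum]
    simp only [Finset.prod_mul_distrib]
  simp only [partitionSum, h1, Finset.sum_mul]
  rw [Finset.sum_comm]
  refine Finset.sum_congr rfl fun j hj => ?_
  rw [Fintype.mem_piFinset] at hj
  rw [← sum_prod_card_pow_mul_moebius fun i => (Finset.mem_Icc.1 (hj i)).1, Finset.mul_sum]
  simp only [mul_assoc]

theorem theorem1p1 (k : ℕ) (hk : 1 ≤ k) (f : Fin k → ℂ[X]) (m : Fin k → ℕ)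
    (hf : ∀ i, (f i).eval 0 = 0) (hdeg : ∀ i, (f i).degree = (m i : WithBot ℕ)) (n : ℕ) :
    ((n : ℤ) = (∑ i, (m i : ℤ)) - ((k : ℤ) - 1) →
      partitionSum f n =
        (Nat.factorial (n - 1) : ℂ) * (n : ℂ) ^ (k - 1) *
          ∏ i, ((m i : ℂ) * (f i).leadingCoeff)) ∧
    ((n : ℤ) > (∑ i, (m i : ℤ)) - ((k : ℤ) - 1) → partitionSum f n = 0) := by
  have hnat : ∀ i, (f i).natDegree = m i := fun i => natDegree_eq_of_degree_eq_some (hdeg i)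
  have hm : ∀ i, 1 ≤ m i := by
    intro i
    by_contra h
    have h0 : m i = 0 := by omega
    have h1 := eq_C_of_natDegree_eq_zero ((hnat i).trans h0)
    rw [coeff_zero_eq_eval_zero, hf i, C_0] at h1
    have := hdeg i
    simp [h1] at this
  have hk' : k ≤ ∑ i, m i := by
    simpa using Finset.sum_le_sum (s := Finset.univ) fun i _ => hm i
  rw [partitionSum_eq hf hnat, ← Nat.cast_sum]
  constructor
  · intro hn
    have hn' : n + k = ∑ i, m i + 1 := by omega
    have hn0 : n ≠ 0 := by omega
    have : NeZero n := ⟨hn0⟩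
    -- Any other exponent vector has a strictly smaller sum, too small to connect `n` vertices.
    rw [Finset.sum_eq_single m]
    · have h := sum_mul_connectSum (V := Fin n) hm (by simpa using hn') 1
      simp only [Pi.one_apply, Finset.sum_const, Finset.card_univ, Fintype.card_fin, nsmul_one,
        Finset.prod_const_one, mul_one] at h
      obtain ⟨l, rfl⟩ := Nat.exists_eq_add_of_le' hk
      have h2 : connectSum (Fin n) m 1 = (n - 1).factorial * (∏ i, (m i : ℂ)) * (n : ℂ) ^ l := by
        -- With unit weights the total weight is `n`; cancelling one factor turns `n ^ k` into `n ^
        -- (k - 1)`.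
        apply mul_left_cancel₀ (Nat.cast_ne_zero.2 hn0 : (n : ℂ) ≠ 0)
        rw [h]
        ring
      simp only [h2, Finset.prod_mul_distrib, leadingCoeff, hnat, Nat.add_sub_cancel]
      ring
    · intro j hj hne
      rw [Fintype.mem_piFinset] at hj
      simp only [Finset.mem_Icc] at hj
      obtain ⟨i, hi⟩ := Function.ne_iff.1 hne
      have hlt : ∑ i, j i < ∑ i, m i := Finset.sum_lt_sum (fun i _ => (hj i).2)
        ⟨i, Finset.mem_univ i, lt_of_le_of_ne (hj i).2 hi⟩
      rw [connectSum_eq_zero (fun i => (hj i).1) (by rw [Fintype.card_fin]; omega), mul_zero]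
    · intro h
      exact absurd (Fintype.mem_piFinset.2 fun i => Finset.mem_Icc.2 ⟨hm i, le_rfl⟩) h
  · intro hn
    refine Finset.sum_eq_zero fun j hj => ?_
    rw [Fintype.mem_piFinset] at hj
    simp only [Finset.mem_Icc] at hj
    have hle : ∑ i, j i ≤ ∑ i, m i := Finset.sum_le_sum fun i _ => (hj i).2
    rw [connectSum_eq_zero (fun i => (hj i).1) (by rw [Fintype.card_fin]; omega), mul_zero]
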